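/- Let $0<R\le\infty$ and let $n,k,l$ be integers with $n\ge 2$, $1\le k<n-1$ and $2\le l\le n$. For $I\subset\mathbb R$, let $\mathbb P_n^l(I)$ be the set of symmetric positive semidefinite real $n\times n$ matrices of rank at most $l$ with all entries in $I$, let $\mathbb P_n^k=\mathbb P_n^k(\mathbb R)$, and let $\mathbb S_n^k$ be the set of all symmetric real $n\times n$ matrices of rank at most $k$. For $f:I\to\mathbb R$ and a matrix $A=(a_{ij})$ with entries in $I$, write $f[A]=(f(a_{ij}))$. Let $I=[0,R)$ or $I=(-R,R)$, and let $f\in C^k(I)$ (with one-sided derivatives at $0$ if $I=[0,R)$). Then the following are equivalent: (1) $f[A]\in\mathbb S_n^k$ for all $A\in\mathbb P_n^l(I)$; (2) there are $r\ge 0$, $a_1,\dots,a_r\in\mathbb R$ and integers $i_1,\dots,i_r\ge 0$ such that $f(x)=\sum_{t=1}^r a_t x^{i_t}$ for all $x\in I$ (with $x^0=1$ for every $x$) and $$\sum_{t=1}^r\binom{i_t+l-1}{l-1}\le k.$$ Similarly, $f[A]\in\mathbb P_n^k$ for all $A\in\mathbb P_n^l(I)$ if and only if $f$ can be written as in (2)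 with $a_t\ge 0$ for all $t$. Moreover, if $I=[0,R)$ and $k\le n-3$, then this last equivalence (the one with $\mathbb P_n^k$ as the target) holds for every function $f:I\to\mathbb R$, without the assumption $f\in C^k(I)$. -/

import Mathlib

namespace RankPreservers

/-- The half-open interval `[0, R)` of real numbers, where `R` may be `∞` (that is, `⊤`). -/
def halfInterval (R : EReal) : Set ℝ := {x : ℝ | 0 ≤ x ∧ (x : EReal) < R}

/-- The symmetric interval `(-R, R)` of real numbers, where `R` may be `∞` (that is, `⊤`). -/
def symInterval (R : EReal) : Set ℝ := {x : ℝ | -R < (x : EReal) ∧ (x : EReal) < R}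

/-- The set of symmetric real `n × n` matrices with entries in `I` and rank at most `k`. -/
def symmRankLE (n k : ℕ) (I : Set ℝ) : Set (Matrix (Fin n) (Fin n) ℝ) :=
  {A | A.IsSymm ∧ (∀ i j, A i j ∈ I) ∧ A.rank ≤ k}

/-- The set of symmetric positive semidefinite real `n × n` matrices with entries in `I` and
rank at most `k`. -/
def psdRankLE (n k : ℕ) (I : Set ℝ) : Set (Matrix (Fin n) (Fin n) ℝ) :=
  {A | A.PosSemidef ∧ (∀ i j, A i j ∈ I) ∧ A.rank ≤ k}

/-- The matrix `f[A]`, obtained by applying `f` to every entry of `A`. A function on an interval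
`I` is represented by a function on `ℝ`; only its values on `I` matter when the entries of `A`
lie in `I`. -/
def entrywise {n : ℕ} (f : ℝ → ℝ) (A : Matrix (Fin n) (Fin n) ℝ) : Matrix (Fin n) (Fin n) ℝ :=
  Matrix.of fun i j => f (A i j)

end RankPreservers

/-!
The proof uses only that `f` is continuous (or, for a positivity preserver, monotone), and
`k + 2 ≤ n`. Gram matrices of `n` vectors of `ℝˡ` with inner products in `I` belong to
`psdRankLE n l I`, so by hypothesis every `n`-point Gram matrix of the kernel
`(u, v) ↦ f ⟨u, v⟩` has rank at most `k`.

*Global rank.* A maximal nonsingular principal Gram matrix of such a kernel has some size `m ≤ k`.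
The Schur complement of the kernel vanishes on the diagonal, as otherwise one point could be added,
and then vanishes off the diagonal, as otherwise two points could be added; this is where
`k + 2 ≤ n` enters. Hence `f ⟨u, v⟩ = ∑ a, φ a u * ψ a v` with `m ≤ k` terms, for all `u` and `v`
(`exists_factorization_of_gram_rank_le`).

*Polynomiality.* Take `u = (α, j δ)` for `j = 0, …, k` and `v = (s / α, h / δ)`, so that
`⟨u, v⟩ = s + j h`. The `k + 1` vectors `φ (u)` are linearly dependent, so
`∑ j, c j * f (s + j h) = 0` for all `s` and all small `h`, with fixed coefficients that are not all
zero. Eliminating the terms one by one yields `Δ_H^k f = 0` for all small steps `H`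
(`fwdDiff_iter_eq_zero_of_sum_eq_zero`). So `f` agrees with a polynomial of degree less than `k` on
every fine grid, and the polynomial does not change when the grid is refined. Continuity
or monotonicity extends the equality to the interior of `I`. At the endpoint `0` of `[0, R)`,
continuity suffices; a positivity preserver is continuous there by a `3 × 3` test.

*Counting.* If `f x = ∑ t, a t * x ^ i t` with distinct exponents and nonzero coefficients, the
multinomial theorem diagonalizes the kernel in the monomials of degrees `i t` in `l` variables.
These are linearly independent on any box, so the kernel has rank exactly
`∑ t, (i t + l - 1).choose (l - 1)`, which is therefore at most `k`; and as that number of points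
fits into an `n × n` matrix, positivity forces `a t ≥ 0`
(`MultiIndex.card_le_of_factorization`, `MultiIndex.nonneg_of_gram_posSemidef`). The converse is the
same expansion read backwards, together with the Schur product theorem.
-/

namespace RankPreservers

open Matrix Polynomial Filter Topology

/-! ### Kernels all of whose Gram matrices have small rank -/

/-- A symmetric kernel all of whose `n`-point Gram matrices have rank at most `k` has rank at most
`k` as a kernel, provided `k + 2 ≤ n`. The margin of two is needed: the kernel may vanish on the
diagonal without vanishing, and then points can be added to a nonsingular Gram matrix only in
pairs. -/
theorem exists_factorization_of_gram_rank_le {X : Type*} (K : X → X → ℝ)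
    (hK : ∀ u v, K u v = K v u) {n k : ℕ} (hkn : k + 2 ≤ n)
    (hrank : ∀ p : Fin n → X, (Matrix.of fun i j => K (p i) (p j)).rank ≤ k) :
    ∃ m ≤ k, ∃ φ ψ : Fin m → X → ℝ, ∀ u v, K u v = ∑ a, φ a u * ψ a v := by
  classical
  rcases isEmpty_or_nonempty X with hX | ⟨⟨x₀⟩⟩
  · exact ⟨0, by omega, fun _ _ => 0, fun _ _ => 0, fun u => isEmptyElim u⟩
  have hcard : ∀ (ι : Type) [Fintype ι] [DecidableEq ι], ∀ p : ι → X,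
      Fintype.card ι ≤ n → (Matrix.of fun i j => K (p i) (p j)).det ≠ 0 → Fintype.card ι ≤ k := by
    intro ι _ _ p hι hdet
    obtain ⟨e⟩ : Nonempty (ι ↪ Fin n) := Function.Embedding.nonempty_of_card_le (by simpa using hι)
    have hext : ∀ i, Function.extend e p (fun _ => x₀) (e i) = p i :=
      fun i => e.injective.extend_apply _ _ _
    have hsub : (Matrix.of fun i j => K (p i) (p j)) =
        (Matrix.of fun i j => K (Function.extend e p (fun _ => x₀) i)
          (Function.extend e p (fun _ => x₀) j)).submatrix e e := by
      ext i j; simp [hext]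
    have h1 := Matrix.rank_of_det_ne_zero hdet
    rw [← h1, hsub]
    exact (Matrix.rank_submatrix_le _ _ _).trans (hrank _)
  -- `m` is the largest size of a nonsingular Gram matrix; by `hcard` and `k + 2 ≤ n` there is
  -- none of size `m + 1` or `m + 2` either.
  let P : ℕ → Prop := fun m => ∃ p : Fin m → X, (Matrix.of fun i j => K (p i) (p j)).det ≠ 0
  have hP0 : P 0 := ⟨fun i => i.elim0, by simp⟩
  set m := Nat.findGreatest P k
  have hmk : m ≤ k := Nat.findGreatest_le k
  obtain ⟨p, hp⟩ : P m := Nat.findGreatest_spec (Nat.zero_le k) hP0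
  have hmax : ∀ (ι : Type) [Fintype ι] [DecidableEq ι], ∀ p : ι → X, m < Fintype.card ι →
      Fintype.card ι ≤ n → (Matrix.of fun i j => K (p i) (p j)).det = 0 := by
    intro ι _ _ q hι hn
    by_contra hdet
    have hle := hcard ι q hn hdet
    refine Nat.findGreatest_is_greatest hι hle ⟨q ∘ (Fintype.equivFin ι).symm, ?_⟩
    have : (Matrix.of fun i j => K ((q ∘ (Fintype.equivFin ι).symm) i)
        ((q ∘ (Fintype.equivFin ι).symm) j)) =
        (Matrix.of fun i j => K (q i) (q j)).submatrix (Fintype.equivFin ι).symm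
          (Fintype.equivFin ι).symm := rfl
    rwa [this, Matrix.det_submatrix_equiv_self]
  set G : Matrix (Fin m) (Fin m) ℝ := Matrix.of fun i j => K (p i) (p j) with hG
  let _ : Invertible G := Matrix.invertibleOfIsUnitDet G (isUnit_iff_ne_zero.mpr hp)
  -- `S` is the Schur complement of `G` in the kernel.
  let S : X → X → ℝ := fun u v => K u v - ∑ a, K u (p a) * ∑ b, (⅟G) a b * K (p b) v
  have hschur : ∀ (r : ℕ) (q : Fin r → X), 1 ≤ r → r ≤ 2 →
      (Matrix.of fun i j => S (q i) (q j)).det = 0 := by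
    intro r q hr1 hr2
    have h0 := hmax (Fin m ⊕ Fin r) (Sum.elim p q) (by simp; omega) (by simp; omega)
    have hblock : (Matrix.of fun i j => K (Sum.elim p q i) (Sum.elim p q j)) =
        Matrix.fromBlocks G (Matrix.of fun i j => K (p i) (q j))
          (Matrix.of fun i j => K (q i) (p j)) (Matrix.of fun i j => K (q i) (q j)) := by
      ext (i | i) (j | j) <;> rfl
    rw [hblock, Matrix.det_fromBlocks₁₁] at h0
    have h1 := (mul_eq_zero.mp h0).resolve_left hp
    convert h1 using 2
    ext i j
    simp only [S, Matrix.of_apply, Matrix.sub_apply, Matrix.mul_assoc, Matrix.mul_apply]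
  have hGsymm : ∀ a b, (⅟G) a b = (⅟G) b a := by
    have : Gᵀ = G := by ext i j; exact hK _ _
    intro a b
    have h2 : (⅟G)ᵀ = ⅟G := by
      rw [Matrix.invOf_eq_nonsing_inv, Matrix.transpose_nonsing_inv, this]
    exact congrFun (congrFun h2 b) a
  have hSsymm : ∀ u v, S u v = S v u := by
    intro u v
    simp only [S, hK u v, Finset.mul_sum]
    rw [Finset.sum_comm]
    congr 1
    refine Finset.sum_congr rfl fun a _ => Finset.sum_congr rfl fun b _ => ?_
    rw [hGsymm, hK u, hK v]; ring
  have hSdiag : ∀ u, S u u = 0 := fun u => by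
    simpa using hschur 1 (fun _ => u) le_rfl one_le_two
  refine ⟨m, hmk, fun a u => K u (p a), fun a v => ∑ b, (⅟G) a b * K (p b) v, fun u v => ?_⟩
  have h2 := hschur 2 ![u, v] one_le_two le_rfl
  simp [Matrix.det_fin_two, hSdiag, hSsymm v u] at h2
  exact sub_eq_zero.mp h2

/-! ### Iterated differences and polynomials -/

/-- If `∑ j ≤ m, F j (s + j * h) = 0` for all `s ∈ [A, B]` and all small `h ≥ 0`, then the `m`-th
differences of `F 0` vanish. The functions `F j` are allowed to differ so that the relation
obtained by eliminating the last term is again of this form. -/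
theorem fwdDiff_iter_eq_zero_of_sum_eq_zero (H : ℝ) (hH : 0 ≤ H) (m : ℕ) :
    ∀ (F : ℕ → ℝ → ℝ) (A B h₀ : ℝ), m * H ≤ h₀ →
      (∀ s ∈ Set.Icc A B, ∀ h ∈ Set.Icc 0 h₀, ∑ j ∈ Finset.range (m + 1), F j (s + j * h) = 0) →
      ∀ s, A ≤ s → s + m * H ≤ B → (fwdDiff H)^[m] (F 0) s = 0 := by
  induction m with
  | zero =>
    intro F A B h₀ h0 hF s hA hB
    simpa using hF s ⟨hA, by simpa using hB⟩ 0 ⟨le_rfl, by simpa using h0⟩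
  | succ m ih =>
    intro F A B h₀ h0 hF s hA hB
    push_cast at h0 hB
    -- The argument `s + (m + 1) * h` of the last term is the same for the pairs `(s, h + t)` and
    -- `(s + (m + 1) * t, h)`, so that term drops out of the difference of the two relations. With
    -- `t = H / (m + 1)`, the role of `F 0` is then played by `Δ_H (F 0)`.
    have hm : (0 : ℝ) < m + 1 := by positivity
    have htH : H / (m + 1) ≤ H := div_le_self hH (by linarith [Nat.cast_nonneg (α := ℝ) m])
    have ht0 : 0 ≤ H / (m + 1) := by positivity
    have hmt : (m + 1) * (H / (m + 1)) = H := by field_simp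
    set t := H / (m + 1) with ht
    have key := ih (fun j z => F j (z + H) - F j (z + j * t)) A (B - H) (h₀ - t) (by linarith) ?_
      s hA (by linarith)
    · rw [Function.iterate_succ_apply]
      convert key using 3
      simp [fwdDiff]
    · intro s' hs' h hh
      have e1 := hF (s' + H) ⟨by linarith [hs'.1], by linarith [hs'.2]⟩ h
        ⟨hh.1, by linarith [hh.2]⟩
      have e2 := hF s' ⟨hs'.1, by linarith [hs'.2]⟩ (h + t) ⟨by linarith [hh.1], by linarith [hh.2]⟩
      rw [Finset.sum_range_succ] at e1 e2
      have e3 : s' + H + ((m + 1 : ℕ) : ℝ) * h = s' + ((m + 1 : ℕ) : ℝ) * (h + t) := by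
        push_cast; linarith
      rw [e3] at e1
      rw [Finset.sum_sub_distrib]
      have e4 : ∀ j ∈ Finset.range (m + 1), F j (s' + j * h + H) = F j (s' + H + j * h) :=
        fun j _ => by congr 1; ring
      have e5 : ∀ j ∈ Finset.range (m + 1), F j (s' + j * h + j * t) = F j (s' + j * (h + t)) :=
        fun j _ => by congr 1; ring
      rw [Finset.sum_congr rfl e4, Finset.sum_congr rfl e5]
      linarith

/-- A function whose `k`-th differences vanish along the points `A + i * H`, `i ≤ N`, agrees there
with its interpolation polynomial at the first `k` of these points. -/
theorem exists_polynomial_eq_on_grid {f : ℝ → ℝ} {k : ℕ} (hk : 0 < k) {A H : ℝ} (hH : H ≠ 0) {N : ℕ}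
    (hf : ∀ i, i + k ≤ N → (fwdDiff H)^[k] f (A + i * H) = 0) :
    ∃ p : ℝ[X], p.degree < k ∧ ∀ i ≤ N, f (A + i * H) = p.eval (A + i * H) := by
  have hinj : Set.InjOn (fun i : ℕ => A + i * H) (Finset.range k : Set ℕ) := by
    intro i _ j _ hij
    have : (i : ℝ) * H = j * H := by simpa using hij
    exact_mod_cast mul_right_cancel₀ hH this
  set p := Lagrange.interpolate (Finset.range k) (fun i : ℕ => A + i * H)
    (fun i : ℕ => f (A + i * H)) with hp
  have hdeg : p.degree < k := by
    have := Lagrange.degree_interpolate_lt (fun i : ℕ => f (A + i * H)) hinj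
    rwa [Finset.card_range] at this
  refine ⟨p, hdeg, fun i => ?_⟩
  induction i using Nat.strong_induction_on with
  | _ i ih =>
    intro hi
    rcases lt_or_ge i k with hik | hik
    · rw [hp]
      exact (Lagrange.eval_interpolate_at_node (fun i : ℕ => f (A + i * H)) hinj
        (Finset.mem_range.mpr hik)).symm
    · obtain ⟨j, rfl⟩ := Nat.exists_eq_add_of_le' hik
      have h1 := hf j hi
      have h2 : (fwdDiff H)^[k] (fun x => p.eval x) (A + j * H) = 0 := by
        set Q := p.comp (C H * X + C (A + j * H)) with hQ
        have hQdeg : Q.natDegree < k := by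
          refine lt_of_le_of_lt natDegree_comp_le ?_
          refine lt_of_le_of_lt (Nat.mul_le_mul_left _ (natDegree_linear_le)) ?_
          rw [mul_one]
          rcases eq_or_ne p 0 with h0 | h0
          · simpa [h0] using hk
          · exact (natDegree_lt_iff_degree_lt h0).mpr hdeg
        have h := congrFun (fwdDiff_iter_eq_zero_of_degree_lt hQdeg) 0
        rw [fwdDiff_iter_eq_sum_shift] at h ⊢
        refine Eq.trans (Finset.sum_congr rfl fun i _ => ?_) h
        simp only [hQ, eval_comp, eval_add, eval_mul, eval_C, eval_X, nsmul_eq_mul, zero_add,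
          mul_one]
        rw [mul_comm H, add_comm]
      rw [fwdDiff_iter_eq_sum_shift, Finset.sum_range_succ] at h1 h2
      have h3 : ∀ i ∈ Finset.range k,
          ((-1 : ℤ) ^ (k - i) * (k.choose i : ℤ)) • f (A + j * H + i • H) =
          ((-1 : ℤ) ^ (k - i) * (k.choose i : ℤ)) • p.eval (A + j * H + i • H) := by
        intro i hi'
        have hik := Finset.mem_range.mp hi'
        have := ih (j + i) (by omega) (by omega)
        push_cast at this
        rw [nsmul_eq_mul, add_assoc, ← add_mul, this]
      rw [Finset.sum_congr rfl h3] at h1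
      have h4 := h1.trans h2.symm
      simp only [Nat.sub_self, pow_zero, Nat.choose_self, Nat.cast_one, mul_one, one_smul,
        nsmul_eq_mul, add_right_inj] at h4
      push_cast
      rw [add_mul, ← add_assoc]
      exact h4

/-- Any `k + 1` of the functions `K u` of a kernel of rank at most `k` are linearly dependent. -/
theorem exists_linear_relation {X : Type*} {K : X → X → ℝ} {m k : ℕ} (hmk : m ≤ k)
    {φ ψ : Fin m → X → ℝ} (hK : ∀ u v, K u v = ∑ a, φ a u * ψ a v) (u : ℕ → X) :
    ∃ c : ℕ → ℝ, (∃ j ≤ k, c j ≠ 0) ∧ ∀ v, ∑ j ∈ Finset.range (k + 1), c j * K (u j) v = 0 := by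
  have hdep : ¬ LinearIndependent ℝ (fun (j : Fin (k + 1)) (a : Fin m) => φ a (u j)) := by
    intro h
    have := h.fintype_card_le_finrank
    simp at this
    omega
  obtain ⟨g, hg, j, hj⟩ := Fintype.not_linearIndependent_iff.mp hdep
  refine ⟨fun i => if h : i < k + 1 then g ⟨i, h⟩ else 0,
    ⟨j, by omega, by simpa [j.is_le] using hj⟩, ?_⟩
  intro v
  rw [← Fin.sum_univ_eq_sum_range (fun i =>
    (if h : i < k + 1 then g ⟨i, h⟩ else 0) * K (u i) v) (k + 1)]
  have hga : ∀ a, ∑ j, g j * φ a (u j) = 0 := fun a => by simpa using congrFun hg a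
  calc _ = ∑ j : Fin (k + 1), ∑ a, (g j * φ a (u j)) * ψ a v := by
        refine Finset.sum_congr rfl fun j _ => ?_
        simp [hK, Finset.mul_sum, mul_assoc, j.is_lt]
    _ = 0 := by
        rw [Finset.sum_comm]
        simp [← Finset.sum_mul, hga]

/-- A fixed nontrivial relation between the values of `f` along all short progressions `s + j * h`
makes the `k`-th differences of `f` vanish. Only some coefficient is known to be nonzero; shifting
the base point to the first such term costs an arbitrarily small piece of the interval at its left
end. -/
theorem fwdDiff_iter_eq_zero_of_relation {f : ℝ → ℝ} {k : ℕ} {c : ℕ → ℝ}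
    (hc : ∃ j ≤ k, c j ≠ 0) {A A' B h₀ : ℝ} (hA : A < A') (h₀pos : 0 < h₀)
    (hrel : ∀ s ∈ Set.Icc A B, ∀ h ∈ Set.Icc 0 h₀,
      ∑ j ∈ Finset.range (k + 1), c j * f (s + j * h) = 0) :
    ∃ H₀ > 0, ∀ H, 0 < H → H ≤ H₀ → ∀ s, A' ≤ s → s + k * H ≤ B →
      (fwdDiff H)^[k] f s = 0 := by
  classical
  set d : ℕ → ℝ := fun j => if j ≤ k then c j else 0 with hd
  have hex : ∃ j, d j ≠ 0 := by
    obtain ⟨j, hj, hcj⟩ := hc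
    exact ⟨j, by simpa [hd, hj] using hcj⟩
  set J := Nat.find hex with hJ
  have hdJ : d J ≠ 0 := Nat.find_spec hex
  have hJk : J ≤ k := by
    by_contra h
    exact hdJ (by simp [hd, h])
  have hJlt : ∀ j < J, d j = 0 := fun j hj => not_not.mp (Nat.find_min hex hj)
  have hk0 : (0 : ℝ) < k + 1 := by positivity
  have hJk' : (J : ℝ) ≤ k + 1 := by exact_mod_cast hJk.trans (Nat.le_succ k)
  set h₁ := min h₀ ((A' - A) / (k + 1)) with hh₁
  have h₁pos : 0 < h₁ := lt_min h₀pos (div_pos (sub_pos.mpr hA) hk0)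
  refine ⟨h₁ / (k + 1), by positivity, fun H hH hHle s hs hsB => ?_⟩
  have hHk : k * H ≤ h₁ := by
    rw [le_div_iff₀ hk0] at hHle
    linarith
  have key := fwdDiff_iter_eq_zero_of_sum_eq_zero H hH.le k (fun j => d (J + j) • f) A' B h₁ hHk ?_
    s hs hsB
  · rw [fwdDiff_iter_const_smul] at key
    simpa using (smul_eq_zero.mp key).resolve_left (by simpa using hdJ)
  · intro s hs h hh
    have hJh : J * h ≤ A' - A := by
      have h2 : h ≤ (A' - A) / (k + 1) := hh.2.trans (min_le_right _ _)
      rw [le_div_iff₀ hk0] at h2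
      nlinarith [hh.1]
    have e := hrel (s - J * h)
      ⟨by linarith [hs.1], by linarith [hs.2, mul_nonneg (Nat.cast_nonneg (α := ℝ) J) hh.1]⟩
      h ⟨hh.1, hh.2.trans (min_le_left _ _)⟩
    -- The coefficients `d` vanish below `J` and above `k`, so shifting the index by `J` is
    -- harmless.
    have s1 := Finset.sum_range_add (fun j : ℕ => d j * f (s - J * h + j * h)) J (k + 1)
    have s2 := Finset.sum_range_add (fun j : ℕ => d j * f (s - J * h + j * h)) (k + 1) J
    rw [add_comm (k + 1) J, s1] at s2
    rw [Finset.sum_eq_zero (s := Finset.range J) fun j hj => by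
      rw [hJlt j (Finset.mem_range.mp hj), zero_mul]] at s2
    rw [Finset.sum_eq_zero (s := Finset.range J) fun j hj => by
      rw [show d (k + 1 + j) = 0 from if_neg (by omega), zero_mul]] at s2
    rw [zero_add, add_zero] at s2
    calc _ = ∑ j ∈ Finset.range (k + 1), d (J + j) * f (s - J * h + (J + j : ℕ) * h) := by
          refine Finset.sum_congr rfl fun j _ => ?_
          simp only [Pi.smul_apply, smul_eq_mul]
          congr 2
          push_cast
          ring
      _ = ∑ j ∈ Finset.range (k + 1), d j * f (s - J * h + j * h) := s2
      _ = 0 := by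
          rw [← e]
          refine Finset.sum_congr rfl fun j hj => ?_
          simp [hd, Nat.lt_succ_iff.mp (Finset.mem_range.mp hj)]

/-- If the `k`-th differences of `f` vanish on `[A, B]` for all small steps, then one polynomial
agrees with `f` at all points that divide `[A, B]` in a rational ratio. -/
theorem exists_polynomial_eq_on_rational_points {f : ℝ → ℝ} {k : ℕ} (hk : 0 < k) {A B H₀ : ℝ}
    (hAB : A < B) (hH₀ : 0 < H₀)
    (hf : ∀ H, 0 < H → H ≤ H₀ → ∀ s, A ≤ s → s + k * H ≤ B → (fwdDiff H)^[k] f s = 0) :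
    ∃ p : ℝ[X], ∀ M : ℕ, 0 < M → ∀ i ≤ M,
      f (A + i * ((B - A) / M)) = p.eval (A + i * ((B - A) / M)) := by
  have hBA : 0 < B - A := sub_pos.mpr hAB
  obtain ⟨N₁, hN₁⟩ := exists_nat_gt ((B - A) / H₀)
  set N := max N₁ k with hN
  have hNk : k ≤ N := le_max_right _ _
  have hN0 : 0 < N := hk.trans_le hNk
  have hgrid : ∀ M : ℕ, 0 < M → ∃ p : ℝ[X], p.degree < k ∧ ∀ i ≤ N * M,
      f (A + i * ((B - A) / (N * M : ℕ))) = p.eval (A + i * ((B - A) / (N * M : ℕ))) := by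
    intro M hM
    have hNM : (0 : ℝ) < (N * M : ℕ) := by exact_mod_cast Nat.mul_pos hN0 hM
    refine exists_polynomial_eq_on_grid hk (div_pos hBA hNM).ne' fun i hi => ?_
    refine hf _ (div_pos hBA hNM) ?_ _ ?_ ?_
    · rw [div_le_iff₀ hNM, ← div_le_iff₀' hH₀]
      refine hN₁.le.trans ?_
      exact_mod_cast (le_max_left N₁ k).trans (Nat.le_mul_of_pos_right N hM)
    · have := div_pos hBA hNM
      nlinarith [Nat.cast_nonneg (α := ℝ) i]
    · have hi' : (i : ℝ) + k ≤ (N * M : ℕ) := by exact_mod_cast hi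
      have h1 : ((N * M : ℕ) : ℝ) * ((B - A) / (N * M : ℕ)) = B - A := by field_simp
      have := mul_le_mul_of_nonneg_right hi' (div_pos hBA hNM).le
      linarith
  obtain ⟨p, hpdeg, hp⟩ := hgrid 1 one_pos
  refine ⟨p, fun M hM i hi => ?_⟩
  obtain ⟨q, hqdeg, hq⟩ := hgrid M hM
  have hN' : (0 : ℝ) < N := by exact_mod_cast hN0
  have hM' : (0 : ℝ) < M := by exact_mod_cast hM
  -- Both polynomials agree with `f` on the coarse grid, which has more than `k` points.
  have hqp : q = p := by
    refine Polynomial.eq_of_degrees_lt_of_eval_index_eq (s := Finset.range k)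
      (v := fun i : ℕ => A + i * ((B - A) / N)) ?_ ?_ ?_ ?_
    · intro i _ j _ hij
      have : (i : ℝ) * ((B - A) / N) = j * ((B - A) / N) := by simpa using hij
      exact_mod_cast mul_right_cancel₀ (div_pos hBA hN').ne' this
    · rwa [Finset.card_range]
    · rwa [Finset.card_range]
    · intro i hi
      have hiN : i ≤ N := (Finset.mem_range.mp hi).le.trans hNk
      have h1 := hp i (by simpa using hiN)
      have h2 := hq (i * M) (Nat.mul_le_mul_right M hiN)
      have h3 : ((i * M : ℕ) : ℝ) * ((B - A) / (N * M : ℕ)) = i * ((B - A) / N) := by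
        push_cast; field_simp
      rw [h3] at h2
      rw [mul_one] at h1
      exact h2.symm.trans h1
  have h2 := hq (N * i) (Nat.mul_le_mul_left N hi)
  have h3 : ((N * i : ℕ) : ℝ) * ((B - A) / (N * M : ℕ)) = i * ((B - A) / M) := by
    push_cast; field_simp
  rw [h3, hqp] at h2
  exact h2

theorem eqOn_of_eq_on_rational_points {f : ℝ → ℝ} {p : ℝ[X]} {A B : ℝ}
    (hreg : ContinuousOn f (Set.Icc A B) ∨ MonotoneOn f (Set.Icc A B))
    (hp : ∀ M : ℕ, 0 < M → ∀ i ≤ M,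
      f (A + i * ((B - A) / M)) = p.eval (A + i * ((B - A) / M))) :
    Set.EqOn f (fun x => p.eval x) (Set.Ioo A B) := by
  intro x hx
  have hBA : 0 < B - A := by linarith [hx.1, hx.2]
  have hdense : ∀ a b, A ≤ a → a < b → b ≤ B → ∃ y ∈ Set.Ioo a b, f y = p.eval y := by
    intro a b ha hab hb
    obtain ⟨q, hq1, hq2⟩ := exists_rat_btwn (div_lt_div_of_pos_right
      (sub_lt_sub_right hab A) hBA)
    rw [div_lt_iff₀ hBA] at hq1
    rw [lt_div_iff₀ hBA] at hq2
    have hq0 : 0 < (q : ℝ) := by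
      by_contra h
      nlinarith
    have hq0' : 0 < q := by exact_mod_cast hq0
    have hq1' : (q : ℝ) ≤ 1 := by
      by_contra h
      nlinarith
    have hnum : ((q.num.toNat : ℕ) : ℝ) = q.num := by
      exact_mod_cast Int.toNat_of_nonneg (Rat.num_nonneg.mpr hq0'.le)
    have hden : (0 : ℝ) < q.den := by exact_mod_cast q.den_pos
    have hqd : (q.num : ℝ) / q.den = q := by exact_mod_cast Rat.num_div_den q
    have hle : q.num.toNat ≤ q.den := by
      have : (q.num.toNat : ℝ) ≤ q.den := by
        rw [hnum]
        rwa [← hqd, div_le_one hden] at hq1'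
      exact_mod_cast this
    have hpt : A + (q.num.toNat : ℝ) * ((B - A) / q.den) = A + q * (B - A) := by
      rw [hnum, ← hqd]; ring
    have := hp q.den q.den_pos q.num.toNat hle
    rw [hpt] at this
    exact ⟨_, ⟨by linarith, by linarith⟩, this⟩
  have hcont : Continuous fun x => p.eval x := p.continuous
  have hR : ∃ᶠ y in 𝓝[>] x, x < y ∧ y < B ∧ f y = p.eval y := by
    rw [(nhdsGT_basis x).frequently_iff]
    intro b hb
    obtain ⟨y, hy, hfy⟩ := hdense x (min b B) hx.1.le (lt_min hb hx.2) (min_le_right _ _)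
    exact ⟨y, ⟨hy.1, hy.2.trans_le (min_le_left _ _)⟩, hy.1, hy.2.trans_le (min_le_right _ _), hfy⟩
  have hL : ∃ᶠ y in 𝓝[<] x, y < x ∧ A < y ∧ f y = p.eval y := by
    rw [(nhdsLT_basis x).frequently_iff]
    intro b hb
    obtain ⟨y, hy, hfy⟩ := hdense (max b A) x (le_max_right _ _) (max_lt hb hx.1) hx.2.le
    exact ⟨y, ⟨(le_max_left _ _).trans_lt hy.1, hy.2⟩, hy.2, (le_max_right _ _).trans_lt hy.1, hfy⟩
  have hxI : x ∈ Set.Icc A B := Set.Ioo_subset_Icc_self hx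
  rcases hreg with hf | hf
  · have h1 : Tendsto f (𝓝[>] x) (𝓝 (f x)) :=
      ((hf x hxI).continuousAt (Icc_mem_nhds hx.1 hx.2)).tendsto.mono_left nhdsWithin_le_nhds
    exact tendsto_nhds_unique_of_frequently_eq h1
      (hcont.continuousAt.tendsto.mono_left nhdsWithin_le_nhds) (hR.mono fun y hy => hy.2.2)
  · refine le_antisymm ?_ ?_
    · refine ge_of_tendsto_of_frequently
        (hcont.continuousAt.tendsto.mono_left (nhdsWithin_le_nhds (s := Set.Ioi x)))
        (hR.mono fun y hy => ?_)
      rw [← hy.2.2]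
      exact hf hxI ⟨hx.1.le.trans hy.1.le, hy.2.1.le⟩ hy.1.le
    · refine le_of_tendsto_of_frequently
        (hcont.continuousAt.tendsto.mono_left (nhdsWithin_le_nhds (s := Set.Iio x)))
        (hL.mono fun y hy => ?_)
      rw [← hy.2.2]
      exact hf ⟨hy.2.1.le, hy.1.le.trans hx.2.le⟩ hxI hy.1.le

theorem exists_polynomial_eqOn_of_forall_Ioo {f : ℝ → ℝ} {J : Set ℝ} (hJ : IsOpen J)
    (hf : ∀ A ∈ J, ∀ B ∈ J, A < B → ∃ p : ℝ[X], Set.EqOn f (fun x => p.eval x) (Set.Ioo A B)) :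
    ∃ p : ℝ[X], Set.EqOn f (fun x => p.eval x) J := by
  rcases J.eq_empty_or_nonempty with rfl | ⟨x₀, hx₀⟩
  · exact ⟨0, Set.eqOn_empty _ _⟩
  have hright : ∀ x ∈ J, ∃ y ∈ J, x < y := by
    intro x hx
    obtain ⟨ε, hε, hball⟩ := Metric.isOpen_iff.mp hJ x hx
    exact ⟨x + ε / 2, hball (by rw [Metric.mem_ball, Real.dist_eq, add_sub_cancel_left,
      abs_of_pos (half_pos hε)]; exact half_lt_self hε), by linarith⟩
  have hleft : ∀ x ∈ J, ∃ y ∈ J, y < x := by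
    intro x hx
    obtain ⟨ε, hε, hball⟩ := Metric.isOpen_iff.mp hJ x hx
    exact ⟨x - ε / 2, hball (by rw [Metric.mem_ball, Real.dist_eq, sub_sub_cancel_left, abs_neg,
      abs_of_pos (half_pos hε)]; exact half_lt_self hε), by linarith⟩
  obtain ⟨x₁, hx₁, hx₀₁⟩ := hright x₀ hx₀
  obtain ⟨p, hp⟩ := hf x₀ hx₀ x₁ hx₁ hx₀₁
  refine ⟨p, fun x hx => ?_⟩
  obtain ⟨a, ha, hax⟩ : ∃ a ∈ J, a < min x x₀ := by
    rcases min_choice x x₀ with h | h <;> rw [h]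
    exacts [hleft x hx, hleft x₀ hx₀]
  obtain ⟨b, hb, hbx⟩ : ∃ b ∈ J, max x x₁ < b := by
    rcases max_choice x x₁ with h | h <;> rw [h]
    exacts [hright x hx, hright x₁ hx₁]
  obtain ⟨q, hq⟩ := hf a ha b hb ((hax.trans_le (min_le_left _ _)).trans
    ((le_max_left _ _).trans_lt hbx))
  have hqp : q = p := by
    refine Polynomial.eq_of_infinite_eval_eq _ _ ((Set.Ioo_infinite hx₀₁).mono fun y hy => ?_)
    have h1 := hp hy
    have h2 := hq (x := y) ⟨(hax.trans_le (min_le_right _ _)).trans hy.1,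
      hy.2.trans ((le_max_right _ _).trans_lt hbx)⟩
    exact h2.symm.trans h1
  rw [← hqp]
  exact hq ⟨hax.trans_le (min_le_left _ _), (le_max_left _ _).trans_lt hbx⟩

/-! ### Monomials in several variables -/

/-- The multi-indices in `l` variables of degree `i t`, for `t : Fin r`. The index `t` is part of
the data, so a degree that occurs several times in `i` contributes its multi-indices several
times. -/
abbrev MultiIndex (l : ℕ) {r : ℕ} (i : Fin r → ℕ) : Type :=
  Σ t : Fin r, ↥(Finset.piAntidiag (Finset.univ : Finset (Fin l)) (i t))

namespace MultiIndex

variable {l r : ℕ} {i : Fin r → ℕ}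

/-- The value at `u` of the monomial with multi-index `β`. -/
def eval (β : MultiIndex l i) (u : Fin l → ℝ) : ℝ := ∏ j, u j ^ β.2.1 j

/-- The coefficient of the monomial `(u ^ β) * (v ^ β)` in `∑ t, a t * ⟨u, v⟩ ^ i t`. -/
def weight (a : Fin r → ℝ) (β : MultiIndex l i) : ℝ :=
  a β.1 * (Nat.multinomial Finset.univ β.2.1 : ℝ)

theorem card_eq (hl : 1 ≤ l) (i : Fin r → ℕ) :
    Fintype.card (MultiIndex l i) = ∑ t, (i t + l - 1).choose (l - 1) := by
  rw [Fintype.card_sigma]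
  refine Finset.sum_congr rfl fun t _ => ?_
  rw [Fintype.card_coe, ← Finset.map_sym_eq_piAntidiag, Finset.card_map, Finset.sym_univ,
    Finset.card_univ, Sym.card_sym_eq_choose, Fintype.card_fin, add_comm l]
  exact Nat.choose_symm_of_eq_add (by omega)

theorem sum_mul_dotProduct_pow (a : Fin r → ℝ) (u v : Fin l → ℝ) :
    ∑ t, a t * (u ⬝ᵥ v) ^ i t = ∑ β : MultiIndex l i, β.eval u * β.weight a * β.eval v := by
  rw [Fintype.sum_sigma]
  refine Finset.sum_congr rfl fun t _ => ?_
  rw [dotProduct, Finset.sum_pow_eq_sum_piAntidiag, Finset.mul_sum, ← Finset.sum_coe_sort]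
  refine Finset.sum_congr rfl fun β _ => ?_
  simp only [eval, weight, mul_pow, Finset.prod_mul_distrib]
  ring

/-- Monomials with distinct multi-indices are linearly independent as functions on a box. -/
theorem eq_zero_of_sum_eval_eq_zero (hi : Function.Injective i) {ε : ℝ} (hε : 0 < ε)
    (c : MultiIndex l i → ℝ)
    (hc : ∀ u : Fin l → ℝ, (∀ j, u j ∈ Set.Ioo 0 ε) → ∑ β, c β * β.eval u = 0) : c = 0 := by
  classical
  let e : MultiIndex l i → (Fin l →₀ ℕ) := fun β => Finsupp.equivFunOnFinite.symm β.2.1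
  have he : Function.Injective e := by
    rintro ⟨t, β, hβ⟩ ⟨t', β', hβ'⟩ h
    have h' : β = β' := Finsupp.equivFunOnFinite.symm.injective h
    subst h'
    have h1 := (Finset.mem_piAntidiag.mp hβ).1
    have h2 := (Finset.mem_piAntidiag.mp hβ').1
    obtain rfl : t = t' := hi (h1.symm.trans h2)
    rfl
  have hzero : ∑ β, MvPolynomial.monomial (e β) (c β) = 0 := by
    refine MvPolynomial.funext_set (fun _ => Set.Ioo 0 ε) (fun _ => Set.Ioo_infinite hε) ?_
    intro u hu
    rw [map_zero, map_sum, ← hc u fun j => hu j trivial]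
    refine Finset.sum_congr rfl fun β _ => ?_
    rw [MvPolynomial.eval_monomial, Finsupp.prod_fintype _ _ (by simp)]
    rfl
  funext β
  have := congrArg (MvPolynomial.coeff (e β)) hzero
  simpa [MvPolynomial.coeff_sum, MvPolynomial.coeff_monomial, he.eq_iff] using this

/-- The box contains as many points as there are monomials at which the matrix of values of the
monomials is invertible. -/
theorem exists_det_ne_zero (hi : Function.Injective i) {ε : ℝ} (hε : 0 < ε) :
    ∃ u : MultiIndex l i → Fin l → ℝ, (∀ γ j, u γ j ∈ Set.Ioo 0 ε) ∧
      (Matrix.of fun γ β : MultiIndex l i => β.eval (u γ)).det ≠ 0 := by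
  classical
  set s : Set (MultiIndex l i → ℝ) :=
    (fun (u : Fin l → ℝ) (β : MultiIndex l i) => β.eval u) '' {u | ∀ j, u j ∈ Set.Ioo 0 ε} with hs
  have hspan : Submodule.span ℝ s = ⊤ := by
    by_contra h
    obtain ⟨L, hL0, hL⟩ := Submodule.exists_le_ker_of_lt_top _ (lt_top_iff_ne_top.mpr h)
    refine hL0 (LinearMap.pi_ext' fun β => LinearMap.ext_ring ?_)
    have hz := eq_zero_of_sum_eval_eq_zero hi hε (fun β => L (Pi.single β 1)) fun u hu => by
      have h0 : L (fun β => β.eval u) = 0 :=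
        hL (Submodule.subset_span ⟨u, hu, rfl⟩)
      rw [← Finset.univ_sum_single (fun β : MultiIndex l i => β.eval u), map_sum] at h0
      rw [← h0]
      refine Finset.sum_congr rfl fun β _ => ?_
      rw [mul_comm, ← smul_eq_mul, ← map_smul, ← Pi.single_smul, smul_eq_mul, mul_one]
    simpa using congrFun hz β
  obtain ⟨b, hbs, hbspan, hblin⟩ := exists_linearIndependent ℝ s
  let bas := Module.Basis.mk hblin (by rw [Subtype.range_coe, hbspan, hspan])
  let σ : b ≃ MultiIndex l i := bas.indexEquiv (Pi.basisFun ℝ (MultiIndex l i))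
  choose u hu using fun γ => hbs (σ.symm γ).2
  refine ⟨u, fun γ => (hu γ).1, ?_⟩
  have hlin : LinearIndependent ℝ
      (Matrix.of fun γ β : MultiIndex l i => β.eval (u γ)).row := by
    have : (Matrix.of fun γ β : MultiIndex l i => β.eval (u γ)).row =
        (fun x : b => (x : MultiIndex l i → ℝ)) ∘ σ.symm := funext fun γ => (hu γ).2
    rw [this]
    exact hblin.comp _ σ.symm.injective
  exact ((Matrix.isUnit_iff_isUnit_det _).mp
    (Matrix.linearIndependent_rows_iff_isUnit.mp hlin)).ne_zero

theorem weight_ne_zero {a : Fin r → ℝ} (ha : ∀ t, a t ≠ 0) (β : MultiIndex l i) :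
    β.weight a ≠ 0 :=
  mul_ne_zero (ha _) (by exact_mod_cast (Nat.multinomial_pos _ _).ne')

theorem of_sum_eq_mul {ι : Type*} (a : Fin r → ℝ) (u v : ι → Fin l → ℝ) :
    (Matrix.of fun x y => ∑ t, a t * (u x ⬝ᵥ v y) ^ i t) =
      (Matrix.of fun x (β : MultiIndex l i) => β.eval (u x)) *
        Matrix.diagonal (fun β : MultiIndex l i => β.weight a) *
        (Matrix.of fun x (β : MultiIndex l i) => β.eval (v x))ᵀ := by
  ext x y
  rw [Matrix.mul_apply]
  simp [sum_mul_dotProduct_pow, Matrix.mul_diagonal]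

/-- The kernel `∑ t, a t * ⟨u, v⟩ ^ i t` on a box cannot be written with fewer product terms than
there are monomials in its expansion. -/
theorem card_le_of_factorization (hi : Function.Injective i) {ε : ℝ} (hε : 0 < ε)
    {a : Fin r → ℝ} (ha : ∀ t, a t ≠ 0) {m : ℕ} {φ ψ : Fin m → (Fin l → ℝ) → ℝ}
    (h : ∀ u v : Fin l → ℝ, (∀ j, u j ∈ Set.Ioo 0 ε) → (∀ j, v j ∈ Set.Ioo 0 ε) →
      ∑ t, a t * (u ⬝ᵥ v) ^ i t = ∑ x, φ x u * ψ x v) :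
    Fintype.card (MultiIndex l i) ≤ m := by
  classical
  obtain ⟨u, hu, hdet⟩ := exists_det_ne_zero (l := l) hi hε
  have h1 : (Matrix.of fun γ γ' => ∑ t, a t * (u γ ⬝ᵥ u γ') ^ i t) =
      (Matrix.of fun γ x => φ x (u γ)) * (Matrix.of fun x γ => ψ x (u γ)) := by
    ext γ γ'
    rw [Matrix.of_apply, h _ _ (hu γ) (hu γ')]
    rfl
  have h2 : (Matrix.of fun γ γ' => ∑ t, a t * (u γ ⬝ᵥ u γ') ^ i t).det ≠ 0 := by
    rw [of_sum_eq_mul, Matrix.det_mul, Matrix.det_mul, Matrix.det_transpose, Matrix.det_diagonal]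
    exact mul_ne_zero (mul_ne_zero hdet (Finset.prod_ne_zero_iff.mpr fun β _ =>
      weight_ne_zero ha β)) hdet
  rw [← Matrix.rank_of_det_ne_zero h2, h1]
  refine (Matrix.rank_mul_le_left _ _).trans ?_
  simpa using Matrix.rank_le_card_width (Matrix.of fun γ x => φ x (u γ))

/-- The coefficients are nonnegative as soon as the Gram matrices with as many points as there are
monomials are positive semidefinite: for suitable points, such a matrix is congruent to the
diagonal matrix of the weights. -/
theorem nonneg_of_gram_posSemidef (hl : 1 ≤ l) (hi : Function.Injective i) {ε : ℝ} (hε : 0 < ε)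
    {a : Fin r → ℝ}
    (h : ∀ u : MultiIndex l i → Fin l → ℝ, (∀ γ j, u γ j ∈ Set.Ioo 0 ε) →
      (Matrix.of fun γ γ' => ∑ t, a t * (u γ ⬝ᵥ u γ') ^ i t).PosSemidef) (t : Fin r) :
    0 ≤ a t := by
  classical
  obtain ⟨u, hu, hdet⟩ := exists_det_ne_zero (l := l) hi hε
  set M := Matrix.of fun γ β : MultiIndex l i => β.eval (u γ) with hM
  have h1 := (h u hu).mul_mul_conjTranspose_same M⁻¹
  have hunit : IsUnit M.det := isUnit_iff_ne_zero.mpr hdet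
  rw [of_sum_eq_mul, ← hM, Matrix.conjTranspose_eq_transpose_of_trivial, Matrix.mul_assoc M,
    Matrix.nonsing_inv_mul_cancel_left _ _ hunit, Matrix.mul_assoc,
    ← Matrix.transpose_mul, Matrix.nonsing_inv_mul _ hunit, Matrix.transpose_one,
    Matrix.mul_one] at h1
  let β : MultiIndex l i := ⟨t, ⟨Pi.single ⟨0, hl⟩ (i t), by simp [Finset.mem_piAntidiag]⟩⟩
  have h2 := (Matrix.posSemidef_diagonal_iff.mp h1) β
  exact nonneg_of_mul_nonneg_left h2 (by exact_mod_cast Nat.multinomial_pos _ _)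

end MultiIndex

/-! ### Entrywise polynomials -/

theorem exists_rank_factorization {n l : ℕ} (A : Matrix (Fin n) (Fin n) ℝ) (hA : A.rank ≤ l) :
    ∃ P Q : Fin n → Fin l → ℝ, ∀ x y, A x y = P x ⬝ᵥ Q y := by
  obtain ⟨d, rfl⟩ := Nat.exists_eq_add_of_le hA
  have hr := A.rank_eq_finrank_span_cols
  set W := Submodule.span ℝ (Set.range A.col)
  let b := Module.finBasisOfFinrankEq ℝ W hr.symm
  have hmem : ∀ y, A.col y ∈ W := fun y => Submodule.subset_span ⟨y, rfl⟩
  refine ⟨fun x => Fin.addCases (fun a => (b a : Fin n → ℝ) x) (fun _ => 0),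
    fun y => Fin.addCases (fun a => b.repr ⟨A.col y, hmem y⟩ a) (fun _ => 0), fun x y => ?_⟩
  have h1 := congrArg (fun w : W => (w : Fin n → ℝ) x) (b.sum_repr ⟨A.col y, hmem y⟩)
  simp only [Submodule.coe_sum, Finset.sum_apply, Submodule.coe_smul, Pi.smul_apply,
    smul_eq_mul] at h1
  simp only [dotProduct, Fin.sum_univ_add, Fin.addCases_left, Fin.addCases_right, mul_zero,
    Finset.sum_const_zero, add_zero]
  rw [show A x y = A.col y x from rfl, ← h1]
  exact Finset.sum_congr rfl fun a _ => mul_comm _ _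

theorem rank_entrywise_sum_pow_le {n l r : ℕ} (hl : 1 ≤ l) (a : Fin r → ℝ) (i : Fin r → ℕ)
    {A : Matrix (Fin n) (Fin n) ℝ} (hA : A.rank ≤ l) :
    (entrywise (fun x => ∑ t, a t * x ^ i t) A).rank ≤ ∑ t, (i t + l - 1).choose (l - 1) := by
  obtain ⟨P, Q, hPQ⟩ := exists_rank_factorization A hA
  have h1 : entrywise (fun x => ∑ t, a t * x ^ i t) A =
      Matrix.of fun x y => ∑ t, a t * (P x ⬝ᵥ Q y) ^ i t := by
    ext x y; simp [entrywise, hPQ]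
  classical
  rw [h1, MultiIndex.of_sum_eq_mul, ← MultiIndex.card_eq hl]
  exact (Matrix.rank_mul_le_right _ _).trans (Matrix.rank_le_card_height _)

theorem posSemidef_entrywise_pow {n : ℕ} {A : Matrix (Fin n) (Fin n) ℝ} (hA : A.PosSemidef)
    (m : ℕ) : (entrywise (fun x => x ^ m) A).PosSemidef := by
  induction m with
  | zero =>
    have : entrywise (fun x => x ^ 0) A =
        Matrix.vecMulVec (fun _ : Fin n => (1 : ℝ)) (star fun _ => 1) := by
      ext x y; simp [entrywise, Matrix.vecMulVec]
    rw [this]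
    exact Matrix.posSemidef_vecMulVec_self_star _
  | succ m ih =>
    have : entrywise (fun x => x ^ (m + 1)) A = (entrywise (fun x => x ^ m) A).hadamard A := by
      ext x y; simp [entrywise, pow_succ]
    rw [this]
    exact ih.hadamard hA

theorem posSemidef_entrywise_sum_pow {n r : ℕ} {a : Fin r → ℝ} (ha : ∀ t, 0 ≤ a t)
    (i : Fin r → ℕ) {A : Matrix (Fin n) (Fin n) ℝ} (hA : A.PosSemidef) :
    (entrywise (fun x => ∑ t, a t * x ^ i t) A).PosSemidef := by
  have : entrywise (fun x => ∑ t, a t * x ^ i t) A =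
      ∑ t, a t • entrywise (fun x => x ^ i t) A := by
    ext x y; simp [entrywise, Matrix.sum_apply]
  rw [this]
  exact Matrix.posSemidef_sum _ fun t _ => (posSemidef_entrywise_pow hA _).smul (ha t)

/-! ### Vectors with inner products in an interval -/

/-- `D` is a set of vectors of `ℝˡ` that is rich enough to study functions on the interval `I`,
where `J` is meant to be the interior of `I`: the inner products of vectors of `D` lie in `I`, `D`
contains a box next to the origin, and progressions `s + j * h` with `j ≤ k` are inner products of
a vector depending only on `j` with a vector depending only on `s` and `h`. In the latter, `s`
ranges over an interval that reaches beyond the given `[A', B]` to the left. -/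
structure IsVectorDomain (k l : ℕ) (I J : Set ℝ) (D : Set (Fin l → ℝ)) : Prop where
  dotProduct_mem : ∀ u ∈ D, ∀ v ∈ D, u ⬝ᵥ v ∈ I
  box : ∃ ε > 0, ∀ u : Fin l → ℝ, (∀ j, u j ∈ Set.Ioo 0 ε) → u ∈ D
  progression : ∀ A' ∈ J, ∀ B ∈ J, A' < B → ∃ A < A', ∃ h₀ > 0,
    ∃ (U : ℕ → Fin l → ℝ) (V : ℝ → ℝ → Fin l → ℝ), (∀ j, U j ∈ D) ∧
      ∀ s ∈ Set.Icc A B, ∀ h ∈ Set.Icc 0 h₀, V s h ∈ D ∧ ∀ j ≤ k, U j ⬝ᵥ V s h = s + j * h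
  isOpen : IsOpen J
  Icc_subset : ∀ A ∈ J, ∀ B ∈ J, Set.Icc A B ⊆ I

/-- The vectors of norm less than `√R` in the closed positive orthant. -/
def orthantDomain (R : EReal) (l : ℕ) : Set (Fin l → ℝ) :=
  {u | (∀ j, 0 ≤ u j) ∧ ((u ⬝ᵥ u : ℝ) : EReal) < R}

/-- The vectors of norm less than `√R`. -/
def ballDomain (R : EReal) (l : ℕ) : Set (Fin l → ℝ) := {u | ((u ⬝ᵥ u : ℝ) : EReal) < R}

/-- The vector `(a, b, 0, …, 0)`. -/
def planeVec (l : ℕ) (a b : ℝ) : Fin l → ℝ :=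
  fun j => if j.val = 0 then a else if j.val = 1 then b else 0

theorem planeVec_dotProduct {l : ℕ} (hl : 2 ≤ l) (a b c d : ℝ) :
    planeVec l a b ⬝ᵥ planeVec l c d = a * c + b * d := by
  obtain ⟨l, rfl⟩ := Nat.exists_eq_add_of_le' hl
  simp [planeVec, dotProduct, Fin.sum_univ_succ]

theorem planeVec_nonneg {l : ℕ} {a b : ℝ} (ha : 0 ≤ a) (hb : 0 ≤ b) (j : Fin l) :
    0 ≤ planeVec l a b j := by
  unfold planeVec
  split_ifs <;> first | assumption | exact le_rfl

theorem abs_dotProduct_le_max {l : ℕ} (u v : Fin l → ℝ) :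
    |u ⬝ᵥ v| ≤ max (u ⬝ᵥ u) (v ⬝ᵥ v) := by
  have h1 : 0 ≤ (u - v) ⬝ᵥ (u - v) := Finset.sum_nonneg fun j _ => mul_self_nonneg _
  have h2 : 0 ≤ (u + v) ⬝ᵥ (u + v) := Finset.sum_nonneg fun j _ => mul_self_nonneg _
  simp only [sub_dotProduct, dotProduct_sub, add_dotProduct, dotProduct_add,
    dotProduct_comm v u] at h1 h2
  have h3 := le_max_left (u ⬝ᵥ u) (v ⬝ᵥ v)
  have h4 := le_max_right (u ⬝ᵥ u) (v ⬝ᵥ v)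
  rw [abs_le]
  constructor <;> linarith

theorem exists_box {R : EReal} (hR : 0 < R) {l : ℕ} (hl : 1 ≤ l) :
    ∃ ε > 0, ∀ u : Fin l → ℝ, (∀ j, u j ∈ Set.Ioo 0 ε) → ((u ⬝ᵥ u : ℝ) : EReal) < R := by
  obtain ⟨c, hc0, hcR⟩ := EReal.lt_iff_exists_real_btwn.mp hR
  have hc : 0 < c := by exact_mod_cast hc0
  have hl' : (0 : ℝ) < l := by exact_mod_cast hl
  refine ⟨√(c / l), Real.sqrt_pos.mpr (div_pos hc hl'), fun u hu => lt_of_le_of_lt ?_ hcR⟩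
  rw [EReal.coe_le_coe_iff]
  calc u ⬝ᵥ u ≤ ∑ _j : Fin l, c / l := Finset.sum_le_sum fun j _ => by
        rw [← Real.mul_self_sqrt (div_pos hc hl').le]
        exact mul_self_le_mul_self (hu j).1.le (hu j).2.le
    _ = c := by simp; field_simp

/-- For `b < R`, the progressions `s + x * h` with `|s| ≤ b` and small `h` are inner products of
the vectors `(α, x * δ, 0, …)` and `(s / α, h / δ, 0, …)` of norm less than `√R`. Here `α ^ 2`
lies strictly between `b` and `R`, which leaves room for the second coordinates. -/
theorem exists_planeVec_progression {R : EReal} {l : ℕ} (hl : 2 ≤ l) (k : ℕ) {b : ℝ} (hb : 0 ≤ b)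
    (hbR : (b : EReal) < R) :
    ∃ α > 0, ∃ δ > 0,
      (∀ j ≤ k, ((planeVec l α (j * δ) ⬝ᵥ planeVec l α (j * δ) : ℝ) : EReal) < R) ∧
      ∀ s, |s| ≤ b → ∀ h ∈ Set.Icc 0 (δ * δ),
        ((planeVec l (s / α) (h / δ) ⬝ᵥ planeVec l (s / α) (h / δ) : ℝ) : EReal) < R ∧
        ∀ x, planeVec l α (x * δ) ⬝ᵥ planeVec l (s / α) (h / δ) = s + x * h := by
  obtain ⟨b', hbb', hb'R⟩ := EReal.lt_iff_exists_real_btwn.mp hbR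
  obtain ⟨c, hb'c, hcR⟩ := EReal.lt_iff_exists_real_btwn.mp hb'R
  have hbb : b < b' := by exact_mod_cast hbb'
  have hbc : b' < c := by exact_mod_cast hb'c
  have hk : (0 : ℝ) < k ^ 2 + 1 := by positivity
  have hα : 0 < √b' := Real.sqrt_pos.mpr (hb.trans_lt hbb)
  have hαα : √b' * √b' = b' := Real.mul_self_sqrt (hb.trans_lt hbb).le
  have hq : 0 < (c - b') / (k ^ 2 + 1) := div_pos (sub_pos.mpr hbc) hk
  have hδ : 0 < √((c - b') / (k ^ 2 + 1)) := Real.sqrt_pos.mpr hq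
  have hδδ := Real.mul_self_sqrt hq.le
  have hmul : (k ^ 2 + 1 : ℝ) * ((c - b') / (k ^ 2 + 1)) = c - b' := by field_simp
  set α := √b'
  set δ := √((c - b') / (k ^ 2 + 1))
  rw [← hδδ] at hmul
  refine ⟨α, hα, δ, hδ, fun j hj => lt_of_le_of_lt ?_ hcR, fun s hs h hh => ⟨lt_of_le_of_lt ?_ hcR,
    fun x => ?_⟩⟩
  · rw [EReal.coe_le_coe_iff, planeVec_dotProduct hl, hαα]
    have : (j : ℝ) ≤ k := by exact_mod_cast hj
    have : (j : ℝ) * j ≤ k * k := mul_self_le_mul_self (Nat.cast_nonneg j) this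
    nlinarith
  · rw [EReal.coe_le_coe_iff, planeVec_dotProduct hl]
    have h1 : s / α * (s / α) ≤ b' := by
      rw [div_mul_div_comm, hαα, div_le_iff₀ (hb.trans_lt hbb)]
      have := abs_le.mp (hs.trans hbb.le)
      nlinarith
    have h2 : h / δ * (h / δ) ≤ δ * δ := by
      have : h / δ ≤ δ := by rw [div_le_iff₀ hδ]; exact hh.2
      exact mul_self_le_mul_self (div_nonneg hh.1 hδ.le) this
    have h3 : δ * δ ≤ c - b' := by nlinarith [sq_nonneg (k : ℝ)]
    linarith
  · rw [planeVec_dotProduct hl]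
    field_simp

theorem isVectorDomain_orthant {R : EReal} (hR : 0 < R) (k : ℕ) {l : ℕ} (hl : 2 ≤ l) :
    IsVectorDomain k l (halfInterval R) {x : ℝ | 0 < x ∧ (x : EReal) < R} (orthantDomain R l) where
  dotProduct_mem u hu v hv := by
    refine ⟨Finset.sum_nonneg fun j _ => mul_nonneg (hu.1 j) (hv.1 j), lt_of_le_of_lt
      (EReal.coe_le_coe_iff.mpr ((le_abs_self _).trans (abs_dotProduct_le_max u v))) ?_⟩
    rcases max_choice (u ⬝ᵥ u) (v ⬝ᵥ v) with h | h <;> rw [h]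
    exacts [hu.2, hv.2]
  box := by
    obtain ⟨ε, hε, h⟩ := exists_box hR (by omega : 1 ≤ l)
    exact ⟨ε, hε, fun u hu => ⟨fun j => (hu j).1.le, h u hu⟩⟩
  progression A' hA' B hB _ := by
    obtain ⟨α, hα, δ, hδ, hU, hV⟩ := exists_planeVec_progression hl k hB.1.le hB.2
    refine ⟨0, hA'.1, δ * δ, mul_pos hδ hδ, fun j => planeVec l α ((min j k : ℕ) * δ),
      fun s h => planeVec l (s / α) (h / δ), fun j => ⟨planeVec_nonneg hα.le (by positivity),
        hU _ (min_le_right _ _)⟩, fun s hs h hh => ?_⟩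
    obtain ⟨h1, h2⟩ := hV s (abs_le.mpr ⟨by linarith [hs.1, hB.1], hs.2⟩) h hh
    refine ⟨⟨planeVec_nonneg (div_nonneg hs.1 hα.le) (div_nonneg hh.1 hδ.le), h1⟩, fun j hj => ?_⟩
    simpa [min_eq_left hj] using h2 j
  isOpen := isOpen_Ioi.inter (isOpen_Iio.preimage continuous_coe_real_ereal)
  Icc_subset A hA B hB x hx :=
    ⟨hA.1.le.trans hx.1, (EReal.coe_le_coe_iff.mpr hx.2).trans_lt hB.2⟩

theorem mem_symInterval_of_abs_le {R : EReal} {x M : ℝ} (hx : |x| ≤ M) (hM : (M : EReal) < R) :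
    x ∈ symInterval R := by
  obtain ⟨h1, h2⟩ := abs_le.mp hx
  refine ⟨?_, (EReal.coe_le_coe_iff.mpr h2).trans_lt hM⟩
  refine (EReal.neg_lt_neg_iff.mpr hM).trans_le ?_
  rw [← EReal.coe_neg, EReal.coe_le_coe_iff]
  exact h1

theorem abs_lt_of_mem_symInterval {R : EReal} {x : ℝ} (hx : x ∈ symInterval R) :
    ((|x| : ℝ) : EReal) < R := by
  rcases abs_choice x with h | h <;> rw [h]
  · exact hx.2
  · rw [EReal.coe_neg]
    exact EReal.neg_lt_comm.mp hx.1

theorem isVectorDomain_ball {R : EReal} (hR : 0 < R) (k : ℕ) {l : ℕ} (hl : 2 ≤ l) :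
    IsVectorDomain k l (symInterval R) (symInterval R) (ballDomain R l) where
  dotProduct_mem u hu v hv := by
    refine mem_symInterval_of_abs_le (abs_dotProduct_le_max u v) ?_
    rcases max_choice (u ⬝ᵥ u) (v ⬝ᵥ v) with h | h <;> rw [h]
    exacts [hu, hv]
  box := exists_box hR (by omega : 1 ≤ l)
  progression A' hA' B hB _ := by
    obtain ⟨b, hb1, hb2⟩ : ∃ b : ℝ, ((max |A'| |B| : ℝ) : EReal) < b ∧ (b : EReal) < R := by
      refine EReal.lt_iff_exists_real_btwn.mp ?_
      rcases max_choice |A'| |B| with h | h <;> rw [h]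
      exacts [abs_lt_of_mem_symInterval hA', abs_lt_of_mem_symInterval hB]
    have hb : max |A'| |B| < b := by exact_mod_cast hb1
    have hbA := abs_lt.mp ((le_max_left _ _).trans_lt hb)
    have hbB := abs_lt.mp ((le_max_right _ _).trans_lt hb)
    obtain ⟨α, hα, δ, hδ, hU, hV⟩ := exists_planeVec_progression hl k
      ((abs_nonneg A').trans ((le_max_left _ _).trans hb.le)) hb2
    refine ⟨-b, hbA.1, δ * δ, mul_pos hδ hδ, fun j => planeVec l α ((min j k : ℕ) * δ),
      fun s h => planeVec l (s / α) (h / δ), fun j => hU _ (min_le_right _ _), fun s hs h hh => ?_⟩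
    obtain ⟨h1, h2⟩ := hV s (abs_le.mpr ⟨hs.1, hs.2.trans hbB.2.le⟩) h hh
    refine ⟨h1, fun j hj => ?_⟩
    simpa [min_eq_left hj] using h2 j
  isOpen := (isOpen_Ioi.preimage continuous_coe_real_ereal).inter
    (isOpen_Iio.preimage continuous_coe_real_ereal)
  Icc_subset A hA B hB x hx :=
    ⟨hA.1.trans_le (EReal.coe_le_coe_iff.mpr hx.1), (EReal.coe_le_coe_iff.mpr hx.2).trans_lt hB.2⟩

theorem gram_mem_psdRankLE {n l : ℕ} {I : Set ℝ} (u : Fin n → Fin l → ℝ)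
    (hu : ∀ x y, u x ⬝ᵥ u y ∈ I) : (Matrix.of fun x y => u x ⬝ᵥ u y) ∈ psdRankLE n l I := by
  have h : (Matrix.of fun x y => u x ⬝ᵥ u y) = Matrix.of u * (Matrix.of u)ᴴ := by
    ext x y; simp [Matrix.mul_apply, dotProduct]
  refine ⟨?_, hu, ?_⟩
  · rw [h]
    exact Matrix.posSemidef_self_mul_conjTranspose _
  · rw [h]
    refine (Matrix.rank_mul_le_left _ _).trans ?_
    simpa using Matrix.rank_le_card_width (Matrix.of u)

namespace IsVectorDomain

variable {n k l : ℕ} {I J : Set ℝ} {D : Set (Fin l → ℝ)} {f : ℝ → ℝ}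

theorem nonempty (hD : IsVectorDomain k l I J D) : D.Nonempty := by
  obtain ⟨ε, hε, h⟩ := hD.box
  exact ⟨fun _ => ε / 2, h _ fun _ => ⟨half_pos hε, half_lt_self hε⟩⟩

theorem exists_factorization (hD : IsVectorDomain k l I J D) (hkn : k + 2 ≤ n)
    (hrank : ∀ A ∈ psdRankLE n l I, (entrywise f A).rank ≤ k) :
    ∃ m ≤ k, ∃ φ ψ : Fin m → D → ℝ, ∀ u v : D, f (u.1 ⬝ᵥ v.1) = ∑ a, φ a u * ψ a v :=
  exists_factorization_of_gram_rank_le (fun u v : D => f (u.1 ⬝ᵥ v.1))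
    (fun u v => by rw [dotProduct_comm]) hkn fun p =>
      hrank _ (gram_mem_psdRankLE (fun x => (p x).1) fun x y =>
        hD.dotProduct_mem _ (p x).2 _ (p y).2)

/-- A continuous or monotone function that maps `psdRankLE n l I` to matrices of rank at most `k`
is a polynomial on `J`. -/
theorem exists_polynomial_eqOn (hD : IsVectorDomain k l I J D) (hk : 0 < k) (hkn : k + 2 ≤ n)
    (hrank : ∀ A ∈ psdRankLE n l I, (entrywise f A).rank ≤ k)
    (hreg : ContinuousOn f I ∨ MonotoneOn f I) :
    ∃ p : ℝ[X], Set.EqOn f (fun x => p.eval x) J := by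
  obtain ⟨m, hmk, φ, ψ, hK⟩ := hD.exists_factorization hkn hrank
  refine exists_polynomial_eqOn_of_forall_Ioo hD.isOpen fun A' hA' B hB hAB => ?_
  obtain ⟨A, hA, h₀, hh₀, U, V, hU, hV⟩ := hD.progression A' hA' B hB hAB
  obtain ⟨c, hc, hrel⟩ := exists_linear_relation hmk hK fun j => ⟨U j, hU j⟩
  obtain ⟨H₀, hH₀, hdiff⟩ := fwdDiff_iter_eq_zero_of_relation (f := f) hc hA hh₀
    fun s hs h hh => by
      obtain ⟨hVD, hUV⟩ := hV s hs h hh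
      rw [← hrel ⟨V s h, hVD⟩]
      refine Finset.sum_congr rfl fun j hj => ?_
      rw [hUV j (Nat.lt_succ_iff.mp (Finset.mem_range.mp hj))]
  obtain ⟨p, hp⟩ := exists_polynomial_eq_on_rational_points hk hAB hH₀ hdiff
  have hsub := hD.Icc_subset A' hA' B hB
  exact ⟨p, eqOn_of_eq_on_rational_points (hreg.imp (·.mono hsub) (·.mono hsub)) hp⟩

theorem exists_reduced_representation (hD : IsVectorDomain k l I J D) (hl : 1 ≤ l)
    (hkn : k + 2 ≤ n) (hrank : ∀ A ∈ psdRankLE n l I, (entrywise f A).rank ≤ k) {p : ℝ[X]}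
    (hp : Set.EqOn f (fun x => p.eval x) I) :
    ∃ (r : ℕ) (a : Fin r → ℝ) (i : Fin r → ℕ), Function.Injective i ∧
      (∀ x ∈ I, f x = ∑ t, a t * x ^ i t) ∧ ∑ t, (i t + l - 1).choose (l - 1) ≤ k := by
  classical
  let e := p.support.equivFin
  have hi : Function.Injective fun t => (e.symm t : ℕ) :=
    Subtype.val_injective.comp e.symm.injective
  have hf : ∀ x ∈ I, f x = ∑ t, p.coeff (e.symm t) * x ^ (e.symm t : ℕ) := by
    intro x hx
    rw [hp hx]
    change p.eval x = _
    rw [Polynomial.eval_eq_sum, Polynomial.sum, ← Finset.sum_coe_sort]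
    exact (e.symm.sum_comp fun s => p.coeff s * x ^ (s : ℕ)).symm
  refine ⟨p.support.card, fun t => p.coeff (e.symm t), fun t => e.symm t, hi, hf, ?_⟩
  obtain ⟨m, hmk, φ, ψ, hK⟩ := hD.exists_factorization hkn hrank
  obtain ⟨ε, hε, hbox⟩ := hD.box
  rw [← MultiIndex.card_eq hl]
  refine le_trans (MultiIndex.card_le_of_factorization hi hε
    (fun t => Polynomial.mem_support_iff.mp (e.symm t).2)
    (φ := fun a u => if h : u ∈ D then φ a ⟨u, h⟩ else 0)
    (ψ := fun a u => if h : u ∈ D then ψ a ⟨u, h⟩ else 0) fun u v hu hv => ?_) hmk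
  have huD := hbox u hu
  have hvD := hbox v hv
  rw [← hf _ (hD.dotProduct_mem u huD v hvD), hK ⟨u, huD⟩ ⟨v, hvD⟩]
  simp [huD, hvD]

theorem gram_posSemidef (hD : IsVectorDomain k l I J D)
    (hpsd : ∀ A ∈ psdRankLE n l I, (entrywise f A).PosSemidef) {ι : Type*} [Fintype ι]
    (hι : Fintype.card ι ≤ n) (u : ι → Fin l → ℝ) (hu : ∀ x, u x ∈ D) :
    (Matrix.of fun x y => f (u x ⬝ᵥ u y)).PosSemidef := by
  obtain ⟨e⟩ : Nonempty (ι ↪ Fin n) := Function.Embedding.nonempty_of_card_le (by simpa using hι)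
  obtain ⟨u₀, hu₀⟩ := hD.nonempty
  let q : ι → D := fun x => ⟨u x, hu x⟩
  let w : Fin n → D := Function.extend e q fun _ => ⟨u₀, hu₀⟩
  have hw : ∀ x, w (e x) = q x := fun x => e.injective.extend_apply _ _ _
  have h := (hpsd _ (gram_mem_psdRankLE (fun x => (w x).1) fun x y =>
    hD.dotProduct_mem _ (w x).2 _ (w y).2)).submatrix e
  convert h using 1
  ext x y
  simp [entrywise, hw, q]

theorem coeff_nonneg (hD : IsVectorDomain k l I J D) (hl : 1 ≤ l) (hkn : k ≤ n)
    (hpsd : ∀ A ∈ psdRankLE n l I, (entrywise f A).PosSemidef) {r : ℕ} {a : Fin r → ℝ}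
    {i : Fin r → ℕ} (hi : Function.Injective i) (hf : ∀ x ∈ I, f x = ∑ t, a t * x ^ i t)
    (hcard : ∑ t, (i t + l - 1).choose (l - 1) ≤ k) (t : Fin r) : 0 ≤ a t := by
  obtain ⟨ε, hε, hbox⟩ := hD.box
  refine MultiIndex.nonneg_of_gram_posSemidef hl hi hε (fun u hu => ?_) t
  rw [← MultiIndex.card_eq hl] at hcard
  convert hD.gram_posSemidef hpsd (hcard.trans hkn) u fun x => hbox _ (hu x) using 1
  ext x y
  exact (hf _ (hD.dotProduct_mem _ (hbox _ (hu x)) _ (hbox _ (hu y)))).symm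

end IsVectorDomain

/-! ### The endpoint `0`, and the theorem -/

theorem eqOn_halfInterval_of_continuousOn {R : EReal} (hR : 0 < R) {f : ℝ → ℝ} {p : ℝ[X]}
    (hf : ContinuousOn f (halfInterval R))
    (hp : Set.EqOn f (fun x => p.eval x) {x : ℝ | 0 < x ∧ (x : EReal) < R}) :
    Set.EqOn f (fun x => p.eval x) (halfInterval R) := by
  intro x hx
  rcases hx.1.eq_or_lt with rfl | hx0
  · obtain ⟨c, hc0, hcR⟩ := EReal.lt_iff_exists_real_btwn.mp hR
    have hc : 0 < c := by exact_mod_cast hc0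
    have hlt : ∀ y ∈ Set.Ioo 0 c, (y : EReal) < R :=
      fun y hy => (EReal.coe_lt_coe_iff.mpr hy.2).trans hcR
    have := left_nhdsWithin_Ioo_neBot hc
    have h1 : Tendsto f (𝓝[Set.Ioo 0 c] 0) (𝓝 (f 0)) :=
      (hf 0 hx).mono fun y hy => ⟨hy.1.le, hlt y hy⟩
    refine tendsto_nhds_unique_of_eventuallyEq h1
      (p.continuous.continuousAt.tendsto.mono_left nhdsWithin_le_nhds) ?_
    filter_upwards [self_mem_nhdsWithin] with y hy
    exact hp ⟨hy.1, hlt y hy⟩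
  · exact hp ⟨hx0, hx.2⟩

section PositivityPreservers

variable {R : EReal} {n k l : ℕ} {f : ℝ → ℝ}

/-- For `b ≤ a`, the test matrix `[[a, b], [b, b]]` gives `f a - f b ≥ 0`. -/
theorem monotoneOn_of_forall_posSemidef
    (hD : IsVectorDomain k l (halfInterval R) {x : ℝ | 0 < x ∧ (x : EReal) < R}
      (orthantDomain R l)) (hl : 2 ≤ l) (hn : 2 ≤ n)
    (hpsd : ∀ A ∈ psdRankLE n l (halfInterval R), (entrywise f A).PosSemidef) :
    MonotoneOn f (halfInterval R) := by
  intro b hb a ha hba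
  have hsb := Real.mul_self_sqrt hb.1
  have hsab := Real.mul_self_sqrt (sub_nonneg.mpr hba)
  have h := hD.gram_posSemidef hpsd (ι := Fin 2) (by simpa using hn)
    ![planeVec l √b √(a - b), planeVec l √b 0] (by
      intro x
      fin_cases x
      · refine ⟨planeVec_nonneg (Real.sqrt_nonneg _) (Real.sqrt_nonneg _), ?_⟩
        simpa [planeVec_dotProduct hl, hsb, hsab] using ha.2
      · refine ⟨planeVec_nonneg (Real.sqrt_nonneg _) le_rfl, ?_⟩
        simpa [planeVec_dotProduct hl, hsb] using hb.2)
  have h2 := h.dotProduct_mulVec_nonneg ![1, -1]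
  simp [Matrix.mulVec, dotProduct, Fin.sum_univ_two] at h2
  simp [← dotProduct.eq_1, planeVec_dotProduct hl, hsb, hsab] at h2
  linarith

/-- A positivity preserver on `[0, R)` is right-continuous at `0`: the Gram matrix of the vectors
`(√y, 0)`, `(0, √y)` and `(√y, √y)` gives `f 0 ≥ 3 * f y - 2 * f (2 * y)`, and `f 0 ≤ f y` by
monotonicity. -/
theorem eqOn_halfInterval_of_forall_posSemidef (hR : 0 < R)
    (hD : IsVectorDomain k l (halfInterval R) {x : ℝ | 0 < x ∧ (x : EReal) < R}
      (orthantDomain R l)) (hl : 2 ≤ l) (hn : 3 ≤ n)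
    (hpsd : ∀ A ∈ psdRankLE n l (halfInterval R), (entrywise f A).PosSemidef) {p : ℝ[X]}
    (hp : Set.EqOn f (fun x => p.eval x) {x : ℝ | 0 < x ∧ (x : EReal) < R}) :
    Set.EqOn f (fun x => p.eval x) (halfInterval R) := by
  intro x hx
  rcases hx.1.eq_or_lt with rfl | hx0
  · obtain ⟨c, hc0, hcR⟩ := EReal.lt_iff_exists_real_btwn.mp hR
    have hc : 0 < c := by exact_mod_cast hc0
    have hlt : ∀ y < c, (y : EReal) < R :=
      fun y hy => (EReal.coe_lt_coe_iff.mpr hy).trans hcR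
    have hmono := monotoneOn_of_forall_posSemidef hD hl (by omega) hpsd
    have hne := left_nhdsWithin_Ioo_neBot (half_pos hc)
    have hpc : Tendsto (fun y => p.eval y) (𝓝[Set.Ioo 0 (c / 2)] 0) (𝓝 (p.eval 0)) :=
      p.continuous.continuousAt.tendsto.mono_left nhdsWithin_le_nhds
    have hpc2 : Tendsto (fun y => p.eval (2 * y)) (𝓝[Set.Ioo 0 (c / 2)] 0) (𝓝 (p.eval 0)) := by
      have : ContinuousAt (fun y : ℝ => p.eval (2 * y)) 0 :=
        (p.continuous.comp (continuous_const.mul continuous_id)).continuousAt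
      have h := this.tendsto.mono_left (nhdsWithin_le_nhds (s := Set.Ioo 0 (c / 2)))
      simpa using h
    refine le_antisymm ?_ ?_
    · refine ge_of_tendsto hpc ?_
      filter_upwards [self_mem_nhdsWithin] with y hy
      have hyR := hlt y (by linarith [hy.2])
      rw [← show f y = p.eval y from hp ⟨hy.1, hyR⟩]
      exact hmono hx ⟨hy.1.le, hyR⟩ hy.1.le
    · have hlim : Tendsto (fun y => 3 * p.eval y - 2 * p.eval (2 * y)) (𝓝[Set.Ioo 0 (c / 2)] 0)
          (𝓝 (3 * p.eval 0 - 2 * p.eval 0)) := (hpc.const_mul 3).sub (hpc2.const_mul 2)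
      refine le_of_tendsto (by convert hlim using 2; ring) ?_
      filter_upwards [self_mem_nhdsWithin] with y hy
      have hyR := hlt y (by linarith [hy.2])
      have h2yR := hlt (2 * y) (by linarith [hy.2])
      rw [← show f y = p.eval y from hp ⟨hy.1, hyR⟩,
        ← show f (2 * y) = p.eval (2 * y) from hp ⟨by linarith [hy.1], h2yR⟩]
      have hsy := Real.mul_self_sqrt hy.1.le
      have hyy : y + y = 2 * y := by ring
      have h := hD.gram_posSemidef hpsd (ι := Fin 3) (by simpa using hn)
        ![planeVec l √y 0, planeVec l 0 √y, planeVec l √y √y] (by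
          intro x
          fin_cases x
          · refine ⟨planeVec_nonneg (Real.sqrt_nonneg _) le_rfl, ?_⟩
            simpa [planeVec_dotProduct hl, hsy] using hyR
          · refine ⟨planeVec_nonneg le_rfl (Real.sqrt_nonneg _), ?_⟩
            simpa [planeVec_dotProduct hl, hsy] using hyR
          · refine ⟨planeVec_nonneg (Real.sqrt_nonneg _) (Real.sqrt_nonneg _), ?_⟩
            simpa [planeVec_dotProduct hl, hsy, hyy] using h2yR)
      have h2 := h.dotProduct_mulVec_nonneg ![1, 1, -2]
      simp [Matrix.mulVec, dotProduct, Fin.sum_univ_three] at h2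
      simp [← dotProduct.eq_1, planeVec_dotProduct hl, hsy, hyy] at h2
      linarith
  · exact hp ⟨hx0, hx.2⟩

end PositivityPreservers

theorem entrywise_congr {n : ℕ} {I : Set ℝ} {f g : ℝ → ℝ} (h : ∀ x ∈ I, f x = g x)
    {A : Matrix (Fin n) (Fin n) ℝ} (hA : ∀ x y, A x y ∈ I) : entrywise f A = entrywise g A := by
  ext x y
  exact h _ (hA x y)

theorem entrywise_mem_symmRankLE {n k l r : ℕ} (hl : 1 ≤ l) {I : Set ℝ} {f : ℝ → ℝ}
    {a : Fin r → ℝ} {i : Fin r → ℕ} (hf : ∀ x ∈ I, f x = ∑ t, a t * x ^ i t)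
    (hk : ∑ t, (i t + l - 1).choose (l - 1) ≤ k) :
    ∀ A ∈ psdRankLE n l I, entrywise f A ∈ symmRankLE n k Set.univ := by
  rintro A ⟨hA, hAI, hAl⟩
  refine ⟨?_, fun _ _ => trivial, ?_⟩
  · ext x y
    have : A y x = A x y := by simpa using hA.isHermitian.apply x y
    simp [entrywise, this]
  · rw [entrywise_congr hf hAI]
    exact (rank_entrywise_sum_pow_le hl a i hAl).trans hk

theorem entrywise_mem_psdRankLE {n k l r : ℕ} (hl : 1 ≤ l) {I : Set ℝ} {f : ℝ → ℝ}
    {a : Fin r → ℝ} {i : Fin r → ℕ} (hf : ∀ x ∈ I, f x = ∑ t, a t * x ^ i t)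
    (hk : ∑ t, (i t + l - 1).choose (l - 1) ≤ k) (ha : ∀ t, 0 ≤ a t) :
    ∀ A ∈ psdRankLE n l I, entrywise f A ∈ psdRankLE n k Set.univ := by
  rintro A ⟨hA, hAI, hAl⟩
  rw [entrywise_congr hf hAI]
  exact ⟨posSemidef_entrywise_sum_pow ha i hA, fun _ _ => trivial,
    (rank_entrywise_sum_pow_le hl a i hAl).trans hk⟩

end RankPreservers

open RankPreservers Polynomial in
theorem theoremB (R : EReal) (hR : 0 < R) (n k l : ℕ) (hn : 2 ≤ n)
    (hk : 1 ≤ k) (hkn : k < n - 1) (hl : 2 ≤ l) (hln : l ≤ n) (f : ℝ → ℝ) :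
    (∀ I : Set ℝ, (I = RankPreservers.halfInterval R ∨ I = RankPreservers.symInterval R) →
      ContDiffOn ℝ (k : ℕ∞) f I →
      ((∀ A ∈ RankPreservers.psdRankLE n l I,
          RankPreservers.entrywise f A ∈ RankPreservers.symmRankLE n k Set.univ) ↔
        ∃ (r : ℕ) (a : Fin r → ℝ) (i : Fin r → ℕ),
          (∀ x ∈ I, f x = ∑ t, a t * x ^ i t) ∧
          ∑ t, (i t + l - 1).choose (l - 1) ≤ k) ∧
      ((∀ A ∈ RankPreservers.psdRankLE n l I,
          RankPreservers.entrywise f A ∈ RankPreservers.psdRankLE n k Set.univ) ↔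
        ∃ (r : ℕ) (a : Fin r → ℝ) (i : Fin r → ℕ),
          (∀ x ∈ I, f x = ∑ t, a t * x ^ i t) ∧
          ∑ t, (i t + l - 1).choose (l - 1) ≤ k ∧
          ∀ t, 0 ≤ a t)) ∧
    (k + 3 ≤ n →
      ((∀ A ∈ RankPreservers.psdRankLE n l (RankPreservers.halfInterval R),
          RankPreservers.entrywise f A ∈ RankPreservers.psdRankLE n k Set.univ) ↔
        ∃ (r : ℕ) (a : Fin r → ℝ) (i : Fin r → ℕ),
          (∀ x ∈ RankPreservers.halfInterval R, f x = ∑ t, a t * x ^ i t) ∧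
          ∑ t, (i t + l - 1).choose (l - 1) ≤ k ∧
          ∀ t, 0 ≤ a t)) := by
  have hkn' : k + 2 ≤ n := by omega
  have hl1 : 1 ≤ l := by omega
  refine ⟨fun I hI hf => ?_, fun _ => ⟨fun h => ?_, ?_⟩⟩
  · obtain ⟨J, D, hD, hJI⟩ : ∃ (J : Set ℝ) (D : Set (Fin l → ℝ)), IsVectorDomain k l I J D ∧
        ∀ p : ℝ[X], Set.EqOn f (fun x => p.eval x) J → Set.EqOn f (fun x => p.eval x) I := by
      rcases hI with rfl | rfl
      · exact ⟨_, _, isVectorDomain_orthant hR k hl,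
          fun p hp => eqOn_halfInterval_of_continuousOn hR hf.continuousOn hp⟩
      · exact ⟨_, _, isVectorDomain_ball hR k hl, fun p hp => hp⟩
    have key : (∀ A ∈ psdRankLE n l I, (entrywise f A).rank ≤ k) →
        ∃ (r : ℕ) (a : Fin r → ℝ) (i : Fin r → ℕ), Function.Injective i ∧
          (∀ x ∈ I, f x = ∑ t, a t * x ^ i t) ∧ ∑ t, (i t + l - 1).choose (l - 1) ≤ k := by
      intro hrank
      obtain ⟨p, hp⟩ := hD.exists_polynomial_eqOn hk hkn' hrank (Or.inl hf.continuousOn)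
      exact hD.exists_reduced_representation hl1 hkn' hrank (hJI p hp)
    refine ⟨⟨fun h => ?_, ?_⟩, ⟨fun h => ?_, ?_⟩⟩
    · obtain ⟨r, a, i, -, hfi, hcard⟩ := key fun A hA => (h A hA).2.2
      exact ⟨r, a, i, hfi, hcard⟩
    · rintro ⟨r, a, i, hfi, hcard⟩
      exact entrywise_mem_symmRankLE hl1 hfi hcard
    · obtain ⟨r, a, i, hi, hfi, hcard⟩ := key fun A hA => (h A hA).2.2
      exact ⟨r, a, i, hfi, hcard,
        hD.coeff_nonneg hl1 (by omega) (fun A hA => (h A hA).1) hi hfi hcard⟩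
    · rintro ⟨r, a, i, hfi, hcard, ha⟩
      exact entrywise_mem_psdRankLE hl1 hfi hcard ha
  · have hD := isVectorDomain_orthant hR k hl
    have hpsd : ∀ A ∈ psdRankLE n l (halfInterval R), (entrywise f A).PosSemidef :=
      fun A hA => (h A hA).1
    have hrank : ∀ A ∈ psdRankLE n l (halfInterval R), (entrywise f A).rank ≤ k :=
      fun A hA => (h A hA).2.2
    obtain ⟨p, hp⟩ := hD.exists_polynomial_eqOn hk hkn' hrank
      (Or.inr (monotoneOn_of_forall_posSemidef hD hl hn hpsd))
    obtain ⟨r, a, i, hi, hfi, hcard⟩ := hD.exists_reduced_representation hl1 hkn' hrank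
      (eqOn_halfInterval_of_forall_posSemidef hR hD hl (by omega) hpsd hp)
    exact ⟨r, a, i, hfi, hcard, hD.coeff_nonneg hl1 (by omega) hpsd hi hfi hcard⟩
  · rintro ⟨r, a, i, hfi, hcard, ha⟩
    exact entrywise_mem_psdRankLE hl1 hfi hcard ha
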